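/- \textbf{Definitions.} A \emph{WHB-algebra} is an algebra $(A,\wedge,\vee,\to,\leftarrow,0,1)$ such that $(A,\wedge,\vee,0,1)$ is a bounded distributive lattice and, for all $a,b,c\in A$: $a\to a=1$; $a\to(b\wedge c)=(a\to b)\wedge(a\to c)$; $(a\vee b)\to c=(a\to c)\wedge(b\to c)$; $(a\to b)\wedge(b\to c)\le a\to c$; $a\leftarrow a=0$; $(a\vee b)\leftarrow c=(a\leftarrow c)\vee(b\leftarrow c)$; $a\leftarrow(b\wedge c)=(a\leftarrow b)\vee(a\leftarrow c)$; $a\leftarrow c\le(a\leftarrow b)\vee(b\leftarrow c)$; $a\wedge((a\to b)\leftarrow 0)\le b$; $a\le b\vee(1\to(a\leftarrow b))$. A \emph{tense algebra} is a Boolean algebra $B$ with unary operations $G,H$ such that, with $Px=\neg H\neg x$ and $Fx=\neg G\neg x$, one has $Px\le y\Leftrightarrow x\le Gy$ and $Fx\le y\Leftrightarrow x\le Hy$. Let $\mathsf{WHB}$ and $\mathsf{TBA}$ be the categories of WHB-algebras and of tense algebras with their homomorphisms, and let $\mathbf F_{WHB}:\mathsf{Set}\to\mathsf{WHB}$ and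 $\mathbf F_{TBA}:\mathsf{Set}\to\mathsf{TBA}$ be the free algebra functors. For a WHB-algebra $A$ let $X(A)$ be the set of prime filters of $A$, let $\sigma_A(a)=\{P\in X(A): a\in P\}$, and define relations on $X(A)$ by $(P,Q)\in R_A$ iff $b\in Q$ whenever $a\to b\in P$ and $a\in Q$, and $(P,Q)\in S_A$ iff $a\leftarrow b\in P$ whenever $a\in Q$ and $b\notin Q$. For $U\subseteq X(A)$ and a relation $\rho$ on $X(A)$ put $\rho^{-1}(U)=\{P: (P,Q)\in\rho \text{ for some } Q\in U\}$. The \emph{free tense extension} $T(A)$ of $A$ is the Boolean algebra of all finite unions of sets $\sigma_A(a)\setminus\sigma_A(b)$ ($a,b\in A$), with $G_A(U)=X(A)\setminus R_A^{-1}(X(A)\setminus U)$ and $H_A(U)=X(A)\setminus S_A^{-1}(X(A)\setminus U)$; a homomorphism $h:A\to B$ induces $T(h)\big(\bigcup_i(\sigma_A(a_i)\setminus\sigma_A(b_i))\big)=\bigcup_i(\sigma_B(h(a_i))\setminus\sigma_B(h(b_i)))$. This is a functor $T:\mathsf{WHB}\to\mathsf{TBA}$. \textbf{Theorem.} (1)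 The functors $\mathbf F_{TBA}$ and $T\circ\mathbf F_{WHB}$ are naturally isomorphic, by a natural isomorphism $g$ such that, for every set $X$ and every $x\in X$, $g_X$ maps the free generator $x$ of $\mathbf F_{TBA}(X)$ to $\sigma_{\mathbf F_{WHB}(X)}(x)$. (2) Let $\varphi\approx\psi$ be an equation in the language $\{\wedge,\vee,\to,\leftarrow,\neg,0,1\}$. Then there is a finite set $\Pi$ of equations in the language $\{\wedge,\vee,\to,\leftarrow,0,1\}$, each of the form $\delta\wedge\varepsilon\approx\delta$ and with all its variables occurring in $\varphi\approx\psi$, such that for every WHB-algebra $A$ whose lattice reduct is Boolean (with $\neg$ interpreted as complement), $A\models\varphi\approx\psi$ if and only if $A\models\Pi$. (3) The same holds for every equation $\varphi\approx\psi$ in the language $\{\wedge,\vee,\neg,G,H,0,1\}$ of tense algebras, when such an equation is interpreted in a WHB-algebra with Boolean lattice reduct by $G(x)=1\to x$ and $H(x)=\neg(\neg x\leftarrow 0)$ (which make it a tense algebra). -/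

import Mathlib

open CategoryTheory Order

universe u v

set_option linter.unusedSectionVars false

/-! ## The algebras -/

/-- Weak Heyting algebras: bounded distributive lattices with a strict implication `→`,
written `sImp`. -/
class WHAlgebra (A : Type u) [DistribLattice A] [BoundedOrder A] where
  sImp : A → A → A
  sImp_self : ∀ a : A, sImp a a = ⊤
  sImp_inf : ∀ a b c : A, sImp a (b ⊓ c) = sImp a b ⊓ sImp a c
  sup_sImp : ∀ a b c : A, sImp (a ⊔ b) c = sImp a c ⊓ sImp b c
  sImp_trans : ∀ a b c : A, sImp a b ⊓ sImp b c ≤ sImp a c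

/-- Weak difference algebras: bounded distributive lattices with a weak difference `←`,
written `wDiff`. -/
class WDAlgebra (A : Type u) [DistribLattice A] [BoundedOrder A] where
  wDiff : A → A → A
  wDiff_self : ∀ a : A, wDiff a a = ⊥
  sup_wDiff : ∀ a b c : A, wDiff (a ⊔ b) c = wDiff a c ⊔ wDiff b c
  wDiff_inf : ∀ a b c : A, wDiff a (b ⊓ c) = wDiff a b ⊔ wDiff a c
  wDiff_trans : ∀ a b c : A, wDiff a c ≤ wDiff a b ⊔ wDiff b c

/-- Weak Heyting Brouwer algebras: double weak Heyting algebras satisfying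
`a ∧ ((a → b) ← 0) ≤ b` and `a ≤ b ∨ (1 → (a ← b))`. -/
class WHBAlgebra (A : Type u) [DistribLattice A] [BoundedOrder A] extends
    WHAlgebra A, WDAlgebra A where
  e1 : ∀ a b : A, a ⊓ wDiff (sImp a b) ⊥ ≤ b
  e2 : ∀ a b : A, a ≤ b ⊔ sImp ⊤ (wDiff a b)

/-- Tense Boolean algebras: Boolean algebras with unary operators `G`, `H` such that
`P ⊣ G` and `F ⊣ H`, where `P x = ¬ H ¬ x` and `F x = ¬ G ¬ x`. -/
class TenseAlgebra (B : Type u) [BooleanAlgebra B] where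
  opG : B → B
  opH : B → B
  gc_P_G : GaloisConnection (fun x => (opH xᶜ)ᶜ) opG
  gc_F_H : GaloisConnection (fun x => (opG xᶜ)ᶜ) opH

open WHAlgebra WDAlgebra WHBAlgebra TenseAlgebra

/-- Homomorphisms of WHB-algebras. -/
structure WHBHom (A B : Type u) [DistribLattice A] [BoundedOrder A] [WHBAlgebra A]
    [DistribLattice B] [BoundedOrder B] [WHBAlgebra B] extends BoundedLatticeHom A B where
  map_sImp' : ∀ a b : A, toFun (sImp a b) = sImp (toFun a) (toFun b)
  map_wDiff' : ∀ a b : A, toFun (wDiff a b) = wDiff (toFun a) (toFun b)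

/-- Homomorphisms of tense algebras.  A bounded lattice homomorphism between Boolean algebras
automatically preserves complements. -/
structure TenseHom (A B : Type u) [BooleanAlgebra A] [TenseAlgebra A]
    [BooleanAlgebra B] [TenseAlgebra B] extends BoundedLatticeHom A B where
  map_opG' : ∀ a : A, toFun (opG a) = opG (toFun a)
  map_opH' : ∀ a : A, toFun (opH a) = opH (toFun a)

theorem WHBHom.ext_fun {A B : Type u} [DistribLattice A] [BoundedOrder A] [WHBAlgebra A]
    [DistribLattice B] [BoundedOrder B] [WHBAlgebra B] {f g : WHBHom A B}
    (h : ∀ a, f.toFun a = g.toFun a) : f = g := by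
  obtain ⟨f, _, _⟩ := f
  obtain ⟨g, _, _⟩ := g
  have : f = g := DFunLike.ext _ _ h
  subst this
  rfl

theorem TenseHom.ext_fun {A B : Type u} [BooleanAlgebra A] [TenseAlgebra A]
    [BooleanAlgebra B] [TenseAlgebra B] {f g : TenseHom A B}
    (h : ∀ a, f.toFun a = g.toFun a) : f = g := by
  obtain ⟨f, _, _⟩ := f
  obtain ⟨g, _, _⟩ := g
  have : f = g := DFunLike.ext _ _ h
  subst this
  rfl

/-- The category of WHB-algebras: objects. -/
structure WHBAlg : Type (u + 1) where
  carrier : Type u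
  [lat : DistribLattice carrier]
  [bdd : BoundedOrder carrier]
  [alg : WHBAlgebra carrier]

attribute [instance] WHBAlg.lat WHBAlg.bdd WHBAlg.alg

/-- The category of tense algebras: objects. -/
structure TBAlg : Type (u + 1) where
  carrier : Type u
  [bool : BooleanAlgebra carrier]
  [alg : TenseAlgebra carrier]

attribute [instance] TBAlg.bool TBAlg.alg

instance : Category.{u} WHBAlg.{u} where
  Hom A B := WHBHom A.carrier B.carrier
  id A := ⟨BoundedLatticeHom.id A.carrier, fun _ _ => rfl, fun _ _ => rfl⟩
  comp {A B C} f g := ⟨g.toBoundedLatticeHom.comp f.toBoundedLatticeHom,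
    fun a b => (congrArg g.toFun (f.map_sImp' a b)).trans (g.map_sImp' _ _),
    fun a b => (congrArg g.toFun (f.map_wDiff' a b)).trans (g.map_wDiff' _ _)⟩

instance : Category.{u} TBAlg.{u} where
  Hom A B := TenseHom A.carrier B.carrier
  id A := ⟨BoundedLatticeHom.id A.carrier, fun _ => rfl, fun _ => rfl⟩
  comp {A B C} f g := ⟨g.toBoundedLatticeHom.comp f.toBoundedLatticeHom,
    fun a => (congrArg g.toFun (f.map_opG' a)).trans (g.map_opG' _),
    fun a => (congrArg g.toFun (f.map_opH' a)).trans (g.map_opH' _)⟩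

/-- The underlying map of an arrow of tense algebras. -/
def TBAlg.homFun {A B : TBAlg.{u}} (f : A ⟶ B) : A.carrier → B.carrier :=
  (show TenseHom A.carrier B.carrier from f).toFun

/-! ## Prime filters and the dual relations -/

section Spectrum

variable (A : Type u) [DistribLattice A] [BoundedOrder A]

/-- The set `X(A)` of prime filters of a bounded distributive lattice. -/
def PrimeFilter : Type u := {F : PFilter A // F.IsPrime}

variable {A}

instance : Membership A (PrimeFilter A) := ⟨fun P a => a ∈ P.1⟩

namespace PrimeFilter

theorem ext' {P Q : PrimeFilter A} (h : ∀ a, a ∈ P ↔ a ∈ Q) : P = Q :=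
  Subtype.ext (SetLike.ext h)

theorem top_mem (P : PrimeFilter A) : (⊤ : A) ∈ P := PFilter.top_mem (F := P.1)

theorem mem_of_le (P : PrimeFilter A) {a b : A} (h : a ≤ b) (ha : a ∈ P) : b ∈ P :=
  PFilter.mem_of_le h ha

theorem inf_mem_iff (P : PrimeFilter A) {a b : A} : a ⊓ b ∈ P ↔ a ∈ P ∧ b ∈ P :=
  PFilter.inf_mem_iff (F := P.1)

theorem bot_notMem (P : PrimeFilter A) : (⊥ : A) ∉ P := by
  obtain ⟨c, hc⟩ := P.2.compl_ideal.Nonempty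
  exact P.2.compl_ideal.IsLowerSet bot_le hc

theorem sup_mem_iff (P : PrimeFilter A) {a b : A} : a ⊔ b ∈ P ↔ a ∈ P ∨ b ∈ P := by
  constructor
  · intro h
    by_contra! hab
    obtain ⟨c, hc, hac, hbc⟩ := P.2.compl_ideal.Directed a hab.1 b hab.2
    exact hc (P.mem_of_le (sup_le hac hbc) h)
  · rintro (h | h)
    · exact P.mem_of_le le_sup_left h
    · exact P.mem_of_le le_sup_right h

/-- A subset with the defining properties of a proper prime filter is a prime filter. -/
def ofSet (F : Set A) (top : ⊤ ∈ F) (bot : ⊥ ∉ F) (up : ∀ a b, a ≤ b → a ∈ F → b ∈ F)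
    (inf : ∀ a b, a ∈ F → b ∈ F → a ⊓ b ∈ F)
    (sup : ∀ a b, a ⊔ b ∈ F → a ∈ F ∨ b ∈ F) : PrimeFilter A :=
  ⟨(IsPFilter.of_def (F := F) ⟨⊤, top⟩
      (fun a ha b hb => ⟨a ⊓ b, inf a b ha hb, inf_le_left, inf_le_right⟩)
      (fun {a b} h ha => up a b h ha)).toPFilter, by
    refine ⟨⟨fun a b hba ha hb => ha (up b a hba hb), ⟨⊥, bot⟩, fun a ha b hb =>
      ⟨a ⊔ b, fun h => ?_, le_sup_left, le_sup_right⟩⟩⟩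
    rcases sup a b h with h | h
    · exact ha h
    · exact hb h⟩

theorem mem_ofSet (F : Set A) {h1 h2 h3 h4 h5} {a : A} :
    a ∈ ofSet F h1 h2 h3 h4 h5 ↔ a ∈ F := Iff.rfl

end PrimeFilter

/-- The Stone map `σ`. -/
def stone (a : A) : Set (PrimeFilter A) := {P | a ∈ P}

theorem stone_inf (a b : A) : stone (a ⊓ b) = stone a ⊓ stone b :=
  Set.ext fun P => P.inf_mem_iff

theorem stone_sup (a b : A) : stone (a ⊔ b) = stone a ⊔ stone b :=
  Set.ext fun P => P.sup_mem_iff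

theorem stone_bot : stone (⊥ : A) = ⊥ := Set.ext fun P => iff_of_false P.bot_notMem id

theorem stone_top : stone (⊤ : A) = ⊤ := Set.ext fun P => iff_of_true P.top_mem trivial

variable (A) in
theorem mem_closure_range_stone (U : Set (PrimeFilter A)) :
    U ∈ BooleanSubalgebra.closure (Set.range (stone (A := A))) ↔
      ∃ (n : ℕ) (a b : Fin n → A), U = ⋃ i, stone (a i) \ stone (b i) := by
  have hs : IsSublattice (Set.range (stone (A := A))) := by
    constructor
    · rintro _ ⟨a, rfl⟩ _ ⟨b, rfl⟩
      exact ⟨a ⊔ b, stone_sup a b⟩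
    · rintro _ ⟨a, rfl⟩ _ ⟨b, rfl⟩
      exact ⟨a ⊓ b, stone_inf a b⟩
  rw [BooleanSubalgebra.mem_closure_iff_sup_sdiff hs ⟨⊥, stone_bot⟩ ⟨⊤, stone_top⟩]
  constructor
  · rintro ⟨t, rfl⟩
    refine ⟨t.card, fun i => (t.equivFin.symm i).1.1.2.choose,
      fun i => (t.equivFin.symm i).1.2.2.choose, ?_⟩
    have h1 : ∀ i, stone ((t.equivFin.symm i).1.1.2.choose) = (t.equivFin.symm i).1.1.1 :=
      fun i => (t.equivFin.symm i).1.1.2.choose_spec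
    have h2 : ∀ i, stone ((t.equivFin.symm i).1.2.2.choose) = (t.equivFin.symm i).1.2.1 :=
      fun i => (t.equivFin.symm i).1.2.2.choose_spec
    simp only [h1, h2]
    ext P
    simp only [Finset.sup_set_eq_biUnion, Set.mem_iUnion]
    constructor
    · rintro ⟨x, hx, hP⟩
      exact ⟨t.equivFin ⟨x, hx⟩, by simpa using hP⟩
    · rintro ⟨i, hP⟩
      exact ⟨_, (t.equivFin.symm i).2, hP⟩
  · rintro ⟨n, a, b, rfl⟩
    classical
    refine ⟨Finset.univ.image fun i => (⟨stone (a i), a i, rfl⟩, ⟨stone (b i), b i, rfl⟩), ?_⟩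
    ext P
    simp

variable (A) in
/-- The free Boolean extension `𝓑(A)`: the finite unions of sets `σ(a) \ σ(b)`. -/
def boolExt : BooleanSubalgebra (Set (PrimeFilter A)) :=
  (BooleanSubalgebra.closure (Set.range (stone (A := A)))).copy
    {U | ∃ (n : ℕ) (a b : Fin n → A), U = ⋃ i, stone (a i) \ stone (b i)}
    (Set.ext fun U => (mem_closure_range_stone A U).symm)

theorem mem_boolExt {U : Set (PrimeFilter A)} :
    U ∈ boolExt A ↔ ∃ (n : ℕ) (a b : Fin n → A), U = ⋃ i, stone (a i) \ stone (b i) := Iff.rfl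

theorem stone_mem_boolExt (a : A) : stone a ∈ boolExt A :=
  (mem_closure_range_stone A _).1 (BooleanSubalgebra.subset_closure ⟨a, rfl⟩)

/-- The Stone map with values in the free Boolean extension. -/
def stoneB (a : A) : boolExt A := ⟨stone a, stone_mem_boolExt a⟩

/-- `ρ⁻¹(U) = {x | ρ(x) ∩ U ≠ ∅}` for a binary relation `ρ` on a set. -/
def relPre {X : Type u} (ρ : X → X → Prop) (U : Set X) : Set X := {x | ∃ y, ρ x y ∧ y ∈ U}

/-- The relation `R_A` on prime filters of a weak Heyting algebra. -/
def relR [WHAlgebra A] (P Q : PrimeFilter A) : Prop :=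
  ∀ a b : A, sImp a b ∈ P → a ∈ Q → b ∈ Q

/-- The relation `S_A` on prime filters of a weak difference algebra. -/
def relS [WDAlgebra A] (P Q : PrimeFilter A) : Prop :=
  ∀ a b : A, a ∈ Q → b ∉ Q → wDiff a b ∈ P

/-- Separation by prime filters closed under a lattice preorder. -/
theorem exists_primeFilter_of_not_rel (r : A → A → Prop) (hle : ∀ a b, a ≤ b → r a b)
    (htr : ∀ a b c, r a b → r b c → r a c)
    (hinf : ∀ a b c, r a b → r a c → r a (b ⊓ c))
    (hsup : ∀ a b c, r a c → r b c → r (a ⊔ b) c) {a b : A} (hab : ¬ r a b) :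
    ∃ Q : PrimeFilter A, a ∈ Q ∧ b ∉ Q ∧ ∀ x y, r x y → x ∈ Q → y ∈ Q := by
  let S : Set (Set A) := {F | a ∈ F ∧ b ∉ F ∧ (∀ x y, r x y → x ∈ F → y ∈ F) ∧
    ∀ x y, x ∈ F → y ∈ F → x ⊓ y ∈ F}
  have h0 : {x | r a x} ∈ S :=
    ⟨hle _ _ le_rfl, hab, fun x y hxy hx => htr _ _ _ hx hxy, fun x y hx hy => hinf _ _ _ hx hy⟩
  obtain ⟨F, -, hF⟩ := zorn_subset_nonempty S (fun c hc hch hne => by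
    refine ⟨⋃₀ c, ⟨?_, ?_, ?_, ?_⟩, fun s hs => Set.subset_sUnion_of_mem hs⟩
    · obtain ⟨s, hs⟩ := hne
      exact ⟨s, hs, (hc hs).1⟩
    · rintro ⟨s, hs, hb⟩
      exact (hc hs).2.1 hb
    · rintro x y hxy ⟨s, hs, hx⟩
      exact ⟨s, hs, (hc hs).2.2.1 x y hxy hx⟩
    · rintro x y ⟨s, hs, hx⟩ ⟨t, ht, hy⟩
      rcases hch.total hs ht with h | h
      · exact ⟨t, ht, (hc ht).2.2.2 x y (h hx) hy⟩
      · exact ⟨s, hs, (hc hs).2.2.2 x y hx (h hy)⟩) _ h0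
  obtain ⟨haF, hbF, hrF, hiF⟩ := hF.prop
  have key : ∀ c, c ∉ F → ∃ f ∈ F, r (f ⊓ c) b := by
    intro c hc
    by_contra! hcon
    have hmem : {y | ∃ f ∈ F, r (f ⊓ c) y} ∈ S := by
      refine ⟨⟨a, haF, hle _ _ inf_le_left⟩, fun ⟨f, hf, h⟩ => hcon f hf h, ?_, ?_⟩
      · rintro x y hxy ⟨f, hf, h⟩
        exact ⟨f, hf, htr _ _ _ h hxy⟩
      · rintro x y ⟨f, hf, h⟩ ⟨g, hg, h'⟩
        refine ⟨f ⊓ g, hiF _ _ hf hg, hinf _ _ _ (htr _ _ _ (hle _ _ ?_) h)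
          (htr _ _ _ (hle _ _ ?_) h')⟩
        · exact inf_le_inf_right _ inf_le_left
        · exact inf_le_inf_right _ inf_le_right
    exact hc (hF.le_of_ge hmem (fun f hf => ⟨f, hf, hle _ _ inf_le_left⟩)
      ⟨a, haF, hle _ _ inf_le_right⟩)
  refine ⟨PrimeFilter.ofSet F (hrF a _ (hle _ _ le_top) haF)
    (fun h => hbF (hrF _ _ (hle _ _ bot_le) h)) (fun x y hxy => hrF x y (hle _ _ hxy)) hiF ?_,
    haF, hbF, hrF⟩
  intro c d hcd
  by_contra! hn
  obtain ⟨f, hf, hfc⟩ := key c hn.1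
  obtain ⟨g, hg, hgd⟩ := key d hn.2
  refine hbF (hrF ((f ⊓ g) ⊓ (c ⊔ d)) b ?_ (hiF _ _ (hiF _ _ hf hg) hcd))
  rw [inf_sup_left]
  exact hsup _ _ _ (htr _ _ _ (hle _ _ (inf_le_inf_right _ inf_le_left)) hfc)
    (htr _ _ _ (hle _ _ (inf_le_inf_right _ inf_le_right)) hgd)

theorem sImp_eq_top [WHAlgebra A] {a b : A} (h : a ≤ b) : sImp a b = ⊤ := by
  have := sImp_inf a a b
  rw [inf_eq_left.2 h, sImp_self, top_inf_eq] at this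
  exact this.symm

theorem wDiff_eq_bot [WDAlgebra A] {a b : A} (h : a ≤ b) : wDiff a b = ⊥ := by
  have := wDiff_inf a a b
  rw [inf_eq_left.2 h, wDiff_self, bot_sup_eq] at this
  exact this.symm

theorem relPre_relR [WHAlgebra A] (a b : A) :
    relPre relR (stone a \ stone b) = (stone (sImp a b))ᶜ := by
  ext P
  constructor
  · rintro ⟨Q, hR, ha, hb⟩ h
    exact hb (hR a b h ha)
  · intro h
    obtain ⟨Q, ha, hb, hQ⟩ := exists_primeFilter_of_not_rel (fun x y => sImp x y ∈ P)
      (fun x y hxy => by rw [sImp_eq_top hxy]; exact P.top_mem)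
      (fun x y z h h' => P.mem_of_le (sImp_trans x y z) (P.inf_mem_iff.2 ⟨h, h'⟩))
      (fun x y z h h' => by rw [sImp_inf]; exact P.inf_mem_iff.2 ⟨h, h'⟩)
      (fun x y z h h' => by rw [sup_sImp]; exact P.inf_mem_iff.2 ⟨h, h'⟩) h
    exact ⟨Q, hQ, ha, hb⟩

theorem relPre_relS [WDAlgebra A] (a b : A) :
    relPre relS (stone a \ stone b) = stone (wDiff a b) := by
  ext P
  constructor
  · rintro ⟨Q, hS, ha, hb⟩
    exact hS a b ha hb
  · intro h
    obtain ⟨Q, ha, hb, hQ⟩ := exists_primeFilter_of_not_rel (fun x y => wDiff x y ∉ P)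
      (fun x y hxy => by rw [wDiff_eq_bot hxy]; exact P.bot_notMem)
      (fun x y z h h' h'' =>
        (P.sup_mem_iff.1 (P.mem_of_le (wDiff_trans x y z) h'')).elim h h')
      (fun x y z h h' => by rw [wDiff_inf, P.sup_mem_iff]; exact not_or.2 ⟨h, h'⟩)
      (fun x y z h h' => by rw [sup_wDiff, P.sup_mem_iff]; exact not_or.2 ⟨h, h'⟩)
      (not_not.2 h)
    exact ⟨Q, fun x y hx hy => by_contra fun hn => hy (hQ x y hn hx), ha, hb⟩

theorem relPre_iUnion {X : Type u} (ρ : X → X → Prop) {ι : Type} (U : ι → Set X) :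
    relPre ρ (⋃ i, U i) = ⋃ i, relPre ρ (U i) := by
  ext x
  simp only [relPre, Set.mem_iUnion, Set.mem_ofPred_eq]
  constructor
  · rintro ⟨y, h, i, hi⟩
    exact ⟨i, y, h, hi⟩
  · rintro ⟨i, y, h, hi⟩
    exact ⟨y, h, i, hi⟩

theorem iUnion_mem_boolExt {n : ℕ} (U : Fin n → Set (PrimeFilter A))
    (h : ∀ i, U i ∈ boolExt A) : (⋃ i, U i) ∈ boolExt A := by
  induction n with
  | zero =>
    rw [Set.iUnion_of_empty]
    exact BooleanSubalgebra.bot_mem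
  | succ n ih =>
    rw [show (⋃ i, U i) = U 0 ∪ ⋃ i : Fin n, U i.succ by
      ext x; simp [Fin.exists_fin_succ]]
    exact BooleanSubalgebra.sup_mem (h 0) (ih _ fun i => h _)

theorem relPre_relR_mem [WHAlgebra A] {U : Set (PrimeFilter A)} (hU : U ∈ boolExt A) :
    relPre relR U ∈ boolExt A := by
  obtain ⟨n, a, b, rfl⟩ := hU
  rw [relPre_iUnion]
  refine iUnion_mem_boolExt _ fun i => ?_
  rw [relPre_relR]
  exact BooleanSubalgebra.compl_mem (stone_mem_boolExt _)

theorem relPre_relS_mem [WDAlgebra A] {U : Set (PrimeFilter A)} (hU : U ∈ boolExt A) :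
    relPre relS U ∈ boolExt A := by
  obtain ⟨n, a, b, rfl⟩ := hU
  rw [relPre_iUnion]
  refine iUnion_mem_boolExt _ fun i => ?_
  rw [relPre_relS]
  exact stone_mem_boolExt _

theorem relS_iff_relR [WHBAlgebra A] (P Q : PrimeFilter A) : relS P Q ↔ relR Q P := by
  constructor
  · intro h a b hab ha
    exact P.mem_of_le (e1 a b) (P.inf_mem_iff.2 ⟨ha, h _ _ hab Q.bot_notMem⟩)
  · intro h a b ha hb
    have := (Q.sup_mem_iff.1 (Q.mem_of_le (e2 a b) ha)).resolve_left hb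
    exact h _ _ this P.top_mem

/-- The operators `G_A(U) = X \ R_A⁻¹(X \ U)` and `H_A(U) = X \ S_A⁻¹(X \ U)` on the free
Boolean extension of a WHB-algebra. -/
instance [WHBAlgebra A] : TenseAlgebra (boolExt A) where
  opG U := ⟨(relPre relR (U : Set (PrimeFilter A))ᶜ)ᶜ,
    BooleanSubalgebra.compl_mem (relPre_relR_mem (BooleanSubalgebra.compl_mem U.2))⟩
  opH U := ⟨(relPre relS (U : Set (PrimeFilter A))ᶜ)ᶜ,
    BooleanSubalgebra.compl_mem (relPre_relS_mem (BooleanSubalgebra.compl_mem U.2))⟩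
  gc_P_G := by
    rintro ⟨U, hU⟩ ⟨V, hV⟩
    change ((relPre relS Uᶜᶜ)ᶜᶜ ⊆ V) ↔ (U ⊆ (relPre relR Vᶜ)ᶜ)
    simp only [compl_compl]
    constructor
    · rintro h x hx ⟨y, hxy, hy⟩
      exact hy (h ⟨x, (relS_iff_relR y x).2 hxy, hx⟩)
    · rintro h x ⟨y, hxy, hy⟩
      by_contra hx
      exact h hy ⟨x, (relS_iff_relR x y).1 hxy, hx⟩
  gc_F_H := by
    rintro ⟨U, hU⟩ ⟨V, hV⟩
    change ((relPre relR Uᶜᶜ)ᶜᶜ ⊆ V) ↔ (U ⊆ (relPre relS Vᶜ)ᶜ)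
    simp only [compl_compl]
    constructor
    · rintro h x hx ⟨y, hxy, hy⟩
      exact hy (h ⟨x, (relS_iff_relR x y).1 hxy, hx⟩)
    · rintro h x ⟨y, hxy, hy⟩
      by_contra hx
      exact h hy ⟨x, (relS_iff_relR y x).2 hxy, hx⟩

end Spectrum

/-! ## The functor `T` -/

section FunctorT

variable {A B : Type u} [DistribLattice A] [BoundedOrder A] [DistribLattice B] [BoundedOrder B]

/-- The dual map `X(h)(P) = h⁻¹(P)`. -/
def dualMap (h : BoundedLatticeHom A B) (P : PrimeFilter B) : PrimeFilter A :=
  PrimeFilter.ofSet {a | h a ∈ P}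
    (by rw [Set.mem_ofPred_eq, map_top]; exact P.top_mem)
    (by rw [Set.mem_ofPred_eq, map_bot]; exact P.bot_notMem)
    (fun _ _ hab ha => P.mem_of_le (OrderHomClass.mono h hab) ha)
    (fun a b ha hb => by
      rw [Set.mem_ofPred_eq, map_inf]; exact P.inf_mem_iff.2 ⟨ha, hb⟩)
    (fun a b hab => by
      rw [Set.mem_ofPred_eq, map_sup] at hab; exact P.sup_mem_iff.1 hab)

theorem preimage_dualMap_stone (h : BoundedLatticeHom A B) (a : A) :
    dualMap h ⁻¹' stone a = stone (h a) := rfl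

theorem preimage_dualMap_iUnion (h : BoundedLatticeHom A B) {n : ℕ} (a b : Fin n → A) :
    dualMap h ⁻¹' (⋃ i, stone (a i) \ stone (b i)) =
      ⋃ i, stone (h (a i)) \ stone (h (b i)) := by
  rw [Set.preimage_iUnion]
  rfl

/-- The Boolean homomorphism `𝓑(h) = X(h)⁻¹`. -/
def boolExtMap (h : BoundedLatticeHom A B) : BoundedLatticeHom (boolExt A) (boolExt B) where
  toFun U := ⟨dualMap h ⁻¹' U, by
    obtain ⟨_, n, a, b, rfl⟩ := U
    exact ⟨n, _, _, preimage_dualMap_iUnion h a b⟩⟩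
  map_sup' _ _ := rfl
  map_inf' _ _ := rfl
  map_top' := rfl
  map_bot' := rfl

variable [WHBAlgebra A] [WHBAlgebra B]

theorem preimage_relPre_relR (h : WHBHom A B) {U : Set (PrimeFilter A)} (hU : U ∈ boolExt A) :
    dualMap h.toBoundedLatticeHom ⁻¹' relPre relR U =
      relPre relR (dualMap h.toBoundedLatticeHom ⁻¹' U) := by
  obtain ⟨n, a, b, rfl⟩ := hU
  rw [preimage_dualMap_iUnion, relPre_iUnion, relPre_iUnion, Set.preimage_iUnion]
  refine Set.iUnion_congr fun i => ?_
  rw [relPre_relR, relPre_relR]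
  exact congrArg (fun x => (stone x)ᶜ) (h.map_sImp' (a i) (b i))

theorem preimage_relPre_relS (h : WHBHom A B) {U : Set (PrimeFilter A)} (hU : U ∈ boolExt A) :
    dualMap h.toBoundedLatticeHom ⁻¹' relPre relS U =
      relPre relS (dualMap h.toBoundedLatticeHom ⁻¹' U) := by
  obtain ⟨n, a, b, rfl⟩ := hU
  rw [preimage_dualMap_iUnion, relPre_iUnion, relPre_iUnion, Set.preimage_iUnion]
  refine Set.iUnion_congr fun i => ?_
  rw [relPre_relS, relPre_relS]
  exact congrArg stone (h.map_wDiff' (a i) (b i))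

/-- The homomorphism of tense algebras `T(h)`, which maps `⋃ i, σ(a i) \ σ(b i)` to
`⋃ i, σ(h (a i)) \ σ(h (b i))`. -/
def tenseExtMap (h : WHBHom A B) : TenseHom (boolExt A) (boolExt B) where
  toBoundedLatticeHom := boolExtMap h.toBoundedLatticeHom
  map_opG' U := Subtype.ext
    (congrArg compl (preimage_relPre_relR h (BooleanSubalgebra.compl_mem U.2)))
  map_opH' U := Subtype.ext
    (congrArg compl (preimage_relPre_relS h (BooleanSubalgebra.compl_mem U.2)))

end FunctorT

/-- The functor `T` sending a WHB-algebra to its free tense extension. -/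
def tenseExt : WHBAlg.{u} ⥤ TBAlg.{u} where
  obj A := ⟨boolExt A.carrier⟩
  map h := tenseExtMap h
  map_id _ := TenseHom.ext_fun fun _ => rfl
  map_comp _ _ := TenseHom.ext_fun fun _ => rfl

/-! ## Languages and free algebras -/

/-- Terms in the language `{∧, ∨, →, ←, 0, 1}` with variables in `X`. -/
inductive WHBTerm (X : Type u) : Type u
  | var : X → WHBTerm X
  | bot : WHBTerm X
  | top : WHBTerm X
  | inf : WHBTerm X → WHBTerm X → WHBTerm X
  | sup : WHBTerm X → WHBTerm X → WHBTerm X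
  | imp : WHBTerm X → WHBTerm X → WHBTerm X
  | diff : WHBTerm X → WHBTerm X → WHBTerm X

/-- Terms in the language `{∧, ∨, →, ←, ¬, 0, 1}` with variables in `X`. -/
inductive WHBNegTerm (X : Type u) : Type u
  | var : X → WHBNegTerm X
  | bot : WHBNegTerm X
  | top : WHBNegTerm X
  | inf : WHBNegTerm X → WHBNegTerm X → WHBNegTerm X
  | sup : WHBNegTerm X → WHBNegTerm X → WHBNegTerm X
  | imp : WHBNegTerm X → WHBNegTerm X → WHBNegTerm X
  | diff : WHBNegTerm X → WHBNegTerm X → WHBNegTerm X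
  | neg : WHBNegTerm X → WHBNegTerm X

/-- Terms in the language `{∧, ∨, ¬, G, H, 0, 1}` with variables in `X`. -/
inductive TenseTerm (X : Type u) : Type u
  | var : X → TenseTerm X
  | bot : TenseTerm X
  | top : TenseTerm X
  | inf : TenseTerm X → TenseTerm X → TenseTerm X
  | sup : TenseTerm X → TenseTerm X → TenseTerm X
  | neg : TenseTerm X → TenseTerm X
  | allG : TenseTerm X → TenseTerm X
  | allH : TenseTerm X → TenseTerm X

namespace WHBTerm

/-- The variables occurring in a term. -/
def vars {X : Type u} : WHBTerm X → Set X
  | var x => {x}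
  | bot => ∅
  | top => ∅
  | inf s t => s.vars ∪ t.vars
  | sup s t => s.vars ∪ t.vars
  | imp s t => s.vars ∪ t.vars
  | diff s t => s.vars ∪ t.vars

/-- The value of a term under an assignment. -/
def eval {X : Type u} {A : Type v} [DistribLattice A] [BoundedOrder A] [WHBAlgebra A]
    (e : X → A) : WHBTerm X → A
  | var x => e x
  | bot => ⊥
  | top => ⊤
  | inf s t => s.eval e ⊓ t.eval e
  | sup s t => s.eval e ⊔ t.eval e
  | imp s t => sImp (s.eval e) (t.eval e)
  | diff s t => wDiff (s.eval e) (t.eval e)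

end WHBTerm

namespace WHBNegTerm

/-- The variables occurring in a term. -/
def vars {X : Type u} : WHBNegTerm X → Set X
  | var x => {x}
  | bot => ∅
  | top => ∅
  | inf s t => s.vars ∪ t.vars
  | sup s t => s.vars ∪ t.vars
  | imp s t => s.vars ∪ t.vars
  | diff s t => s.vars ∪ t.vars
  | neg s => s.vars

/-- The value of a term under an assignment in a WHB-algebra with Boolean lattice reduct. -/
def eval {X : Type u} {A : Type v} [BooleanAlgebra A] [WHBAlgebra A]
    (e : X → A) : WHBNegTerm X → A
  | var x => e x
  | bot => ⊥
  | top => ⊤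
  | inf s t => s.eval e ⊓ t.eval e
  | sup s t => s.eval e ⊔ t.eval e
  | imp s t => sImp (s.eval e) (t.eval e)
  | diff s t => wDiff (s.eval e) (t.eval e)
  | neg s => (s.eval e)ᶜ

end WHBNegTerm

namespace TenseTerm

/-- The variables occurring in a term. -/
def vars {X : Type u} : TenseTerm X → Set X
  | var x => {x}
  | bot => ∅
  | top => ∅
  | inf s t => s.vars ∪ t.vars
  | sup s t => s.vars ∪ t.vars
  | neg s => s.vars
  | allG s => s.vars
  | allH s => s.vars

/-- The value of a term under an assignment. -/
def eval {X : Type u} {B : Type v} [BooleanAlgebra B] [TenseAlgebra B]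
    (e : X → B) : TenseTerm X → B
  | var x => e x
  | bot => ⊥
  | top => ⊤
  | inf s t => s.eval e ⊓ t.eval e
  | sup s t => s.eval e ⊔ t.eval e
  | neg s => (s.eval e)ᶜ
  | allG s => opG (s.eval e)
  | allH s => opH (s.eval e)

end TenseTerm

/-- The equational theory of WHB-algebras, as a relation on terms. -/
def whbTheory (X : Type u) : Setoid (WHBTerm X) where
  r s t := ∀ (A : Type u) [DistribLattice A] [BoundedOrder A] [WHBAlgebra A] (e : X → A),
    s.eval e = t.eval e
  iseqv :=
    { refl := fun _ _ _ _ _ _ => rfl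
      symm := fun h A _ _ _ e => (h A e).symm
      trans := fun h h' A _ _ _ e => (h A e).trans (h' A e) }

/-- The equational theory of tense algebras, as a relation on terms. -/
def tenseTheory (X : Type u) : Setoid (TenseTerm X) where
  r s t := ∀ (B : Type u) [BooleanAlgebra B] [TenseAlgebra B] (e : X → B),
    s.eval e = t.eval e
  iseqv :=
    { refl := fun _ _ _ _ _ => rfl
      symm := fun h A _ _ e => (h A e).symm
      trans := fun h h' A _ _ e => (h A e).trans (h' A e) }

/-- The free WHB-algebra on `X`: terms modulo the equational theory of WHB-algebras. -/
def FreeWHB (X : Type u) : Type u := Quotient (whbTheory X)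

/-- The free tense algebra on `X`: terms modulo the equational theory of tense algebras. -/
def FreeTense (X : Type u) : Type u := Quotient (tenseTheory X)

namespace FreeWHB

variable {X : Type u}

/-- The class of a term. -/
def mk (t : WHBTerm X) : FreeWHB X := Quotient.mk (whbTheory X) t

/-- The free generators. -/
def gen (x : X) : FreeWHB X := mk (.var x)

theorem sound {s t : WHBTerm X} (h : ∀ (A : Type u) [DistribLattice A] [BoundedOrder A]
    [WHBAlgebra A] (e : X → A), s.eval e = t.eval e) : mk s = mk t := Quotient.sound h

theorem exact {s t : WHBTerm X} (h : mk s = mk t) (A : Type u) [DistribLattice A]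
    [BoundedOrder A] [WHBAlgebra A] (e : X → A) : s.eval e = t.eval e :=
  (Quotient.exact h : (whbTheory X).r s t) A e

@[elab_as_elim]
theorem ind {p : FreeWHB X → Prop} (h : ∀ t, p (mk t)) (a : FreeWHB X) : p a :=
  Quotient.ind h a

/-- A binary operation on the quotient. -/
def map₂ (f : WHBTerm X → WHBTerm X → WHBTerm X)
    (hf : ∀ {s s' t t'}, (whbTheory X).r s s' → (whbTheory X).r t t' →
      (whbTheory X).r (f s t) (f s' t')) : FreeWHB X → FreeWHB X → FreeWHB X :=
  Quotient.map₂ f fun _ _ h _ _ h' => hf h h'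

instance : Max (FreeWHB X) := ⟨map₂ .sup fun h h' A _ _ _ e => congrArg₂ (· ⊔ ·) (h A e) (h' A e)⟩

instance : Min (FreeWHB X) := ⟨map₂ .inf fun h h' A _ _ _ e => congrArg₂ (· ⊓ ·) (h A e) (h' A e)⟩

instance : Top (FreeWHB X) := ⟨mk .top⟩

instance : Bot (FreeWHB X) := ⟨mk .bot⟩

instance : Lattice (FreeWHB X) := Lattice.mk'
  (fun a b => by
    induction a using ind; induction b using ind
    exact sound fun A _ _ _ e => sup_comm _ _)
  (fun a b c => by
    induction a using ind; induction b using ind; induction c using ind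
    exact sound fun A _ _ _ e => sup_assoc _ _ _)
  (fun a b => by
    induction a using ind; induction b using ind
    exact sound fun A _ _ _ e => inf_comm _ _)
  (fun a b c => by
    induction a using ind; induction b using ind; induction c using ind
    exact sound fun A _ _ _ e => inf_assoc _ _ _)
  (fun a b => by
    induction a using ind; induction b using ind
    exact sound fun A _ _ _ e => sup_inf_self)
  (fun a b => by
    induction a using ind; induction b using ind
    exact sound fun A _ _ _ e => inf_sup_self)

theorem mk_le_mk {s t : WHBTerm X} : mk s ≤ mk t ↔ ∀ (A : Type u) [DistribLattice A]
    [BoundedOrder A] [WHBAlgebra A] (e : X → A), s.eval e ≤ t.eval e := by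
  rw [← sup_eq_right]
  constructor
  · intro h A _ _ _ e
    exact sup_eq_right.1 (exact (s := .sup s t) h A e)
  · intro h
    exact sound (s := .sup s t) fun A _ _ _ e => sup_eq_right.2 (h A e)

instance : DistribLattice (FreeWHB X) where
  le_sup_inf a b c := by
    induction a using ind; induction b using ind; induction c using ind
    exact mk_le_mk.2 fun A _ _ _ e => le_sup_inf

instance : BoundedOrder (FreeWHB X) where
  le_top a := by
    induction a using ind
    exact mk_le_mk.2 fun A _ _ _ e => le_top
  bot_le a := by
    induction a using ind
    exact mk_le_mk.2 fun A _ _ _ e => bot_le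

instance : WHBAlgebra (FreeWHB X) where
  sImp := map₂ .imp fun h h' A _ _ _ e => congrArg₂ sImp (h A e) (h' A e)
  wDiff := map₂ .diff fun h h' A _ _ _ e => congrArg₂ wDiff (h A e) (h' A e)
  sImp_self a := by
    induction a using ind
    exact sound fun A _ _ _ e => sImp_self _
  sImp_inf a b c := by
    induction a using ind; induction b using ind; induction c using ind
    exact sound fun A _ _ _ e => sImp_inf _ _ _
  sup_sImp a b c := by
    induction a using ind; induction b using ind; induction c using ind
    exact sound fun A _ _ _ e => sup_sImp _ _ _
  sImp_trans a b c := by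
    induction a using ind; induction b using ind; induction c using ind
    exact mk_le_mk.2 fun A _ _ _ e => sImp_trans _ _ _
  wDiff_self a := by
    induction a using ind
    exact sound fun A _ _ _ e => wDiff_self _
  sup_wDiff a b c := by
    induction a using ind; induction b using ind; induction c using ind
    exact sound fun A _ _ _ e => sup_wDiff _ _ _
  wDiff_inf a b c := by
    induction a using ind; induction b using ind; induction c using ind
    exact sound fun A _ _ _ e => wDiff_inf _ _ _
  wDiff_trans a b c := by
    induction a using ind; induction b using ind; induction c using ind
    exact mk_le_mk.2 fun A _ _ _ e => wDiff_trans _ _ _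
  e1 a b := by
    induction a using ind; induction b using ind
    exact mk_le_mk.2 fun A _ _ _ e => e1 _ _
  e2 a b := by
    induction a using ind; induction b using ind
    exact mk_le_mk.2 fun A _ _ _ e => e2 _ _

/-- The homomorphism from the free WHB-algebra that extends an assignment. -/
def lift {A : Type u} [DistribLattice A] [BoundedOrder A] [WHBAlgebra A] (e : X → A) :
    WHBHom (FreeWHB X) A where
  toFun := Quotient.lift (WHBTerm.eval e) fun _ _ h => h A e
  map_sup' a b := by induction a using ind; induction b using ind; rfl
  map_inf' a b := by induction a using ind; induction b using ind; rfl
  map_top' := rfl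
  map_bot' := rfl
  map_sImp' a b := by induction a using ind; induction b using ind; rfl
  map_wDiff' a b := by induction a using ind; induction b using ind; rfl

theorem hom_ext {A : Type u} [DistribLattice A] [BoundedOrder A] [WHBAlgebra A]
    {f g : WHBHom (FreeWHB X) A} (h : ∀ x, f.toFun (gen x) = g.toFun (gen x)) : f = g := by
  refine WHBHom.ext_fun fun a => ?_
  induction a using ind with | h t => ?_
  induction t with
  | var x => exact h x
  | bot => exact f.map_bot'.trans g.map_bot'.symm
  | top => exact f.map_top'.trans g.map_top'.symm
  | inf s t hs ht =>
    exact (f.map_inf' (mk s) (mk t)).trans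
      ((congrArg₂ (· ⊓ ·) hs ht).trans (g.map_inf' (mk s) (mk t)).symm)
  | sup s t hs ht =>
    exact (f.map_sup' (mk s) (mk t)).trans
      ((congrArg₂ (· ⊔ ·) hs ht).trans (g.map_sup' (mk s) (mk t)).symm)
  | imp s t hs ht =>
    exact (f.map_sImp' (mk s) (mk t)).trans
      ((congrArg₂ sImp hs ht).trans (g.map_sImp' (mk s) (mk t)).symm)
  | diff s t hs ht =>
    exact (f.map_wDiff' (mk s) (mk t)).trans
      ((congrArg₂ wDiff hs ht).trans (g.map_wDiff' (mk s) (mk t)).symm)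

end FreeWHB

namespace FreeTense

variable {X : Type u}

/-- The class of a term. -/
def mk (t : TenseTerm X) : FreeTense X := Quotient.mk (tenseTheory X) t

/-- The free generators. -/
def gen (x : X) : FreeTense X := mk (.var x)

theorem sound {s t : TenseTerm X} (h : ∀ (B : Type u) [BooleanAlgebra B]
    [TenseAlgebra B] (e : X → B), s.eval e = t.eval e) : mk s = mk t := Quotient.sound h

theorem exact {s t : TenseTerm X} (h : mk s = mk t) (B : Type u) [BooleanAlgebra B]
    [TenseAlgebra B] (e : X → B) : s.eval e = t.eval e :=
  (Quotient.exact h : (tenseTheory X).r s t) B e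

@[elab_as_elim]
theorem ind {p : FreeTense X → Prop} (h : ∀ t, p (mk t)) (a : FreeTense X) : p a :=
  Quotient.ind h a

/-- A unary operation on the quotient. -/
def map₁ (f : TenseTerm X → TenseTerm X)
    (hf : ∀ {s s'}, (tenseTheory X).r s s' → (tenseTheory X).r (f s) (f s')) :
    FreeTense X → FreeTense X :=
  Quotient.map f fun _ _ h => hf h

/-- A binary operation on the quotient. -/
def map₂ (f : TenseTerm X → TenseTerm X → TenseTerm X)
    (hf : ∀ {s s' t t'}, (tenseTheory X).r s s' → (tenseTheory X).r t t' →
      (tenseTheory X).r (f s t) (f s' t')) : FreeTense X → FreeTense X → FreeTense X :=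
  Quotient.map₂ f fun _ _ h _ _ h' => hf h h'

instance : Max (FreeTense X) := ⟨map₂ .sup fun h h' A _ _ e => congrArg₂ (· ⊔ ·) (h A e) (h' A e)⟩

instance : Min (FreeTense X) := ⟨map₂ .inf fun h h' A _ _ e => congrArg₂ (· ⊓ ·) (h A e) (h' A e)⟩

instance : Lattice (FreeTense X) := Lattice.mk'
  (fun a b => by
    induction a using ind; induction b using ind
    exact sound fun A _ _ e => sup_comm _ _)
  (fun a b c => by
    induction a using ind; induction b using ind; induction c using ind
    exact sound fun A _ _ e => sup_assoc _ _ _)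
  (fun a b => by
    induction a using ind; induction b using ind
    exact sound fun A _ _ e => inf_comm _ _)
  (fun a b c => by
    induction a using ind; induction b using ind; induction c using ind
    exact sound fun A _ _ e => inf_assoc _ _ _)
  (fun a b => by
    induction a using ind; induction b using ind
    exact sound fun A _ _ e => sup_inf_self)
  (fun a b => by
    induction a using ind; induction b using ind
    exact sound fun A _ _ e => inf_sup_self)

theorem mk_le_mk {s t : TenseTerm X} : mk s ≤ mk t ↔ ∀ (B : Type u) [BooleanAlgebra B]
    [TenseAlgebra B] (e : X → B), s.eval e ≤ t.eval e := by
  rw [← sup_eq_right]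
  constructor
  · intro h A _ _ e
    exact sup_eq_right.1 (exact (s := .sup s t) h A e)
  · intro h
    exact sound (s := .sup s t) fun A _ _ e => sup_eq_right.2 (h A e)

instance : DistribLattice (FreeTense X) where
  le_sup_inf a b c := by
    induction a using ind; induction b using ind; induction c using ind
    exact mk_le_mk.2 fun A _ _ e => le_sup_inf

instance : BooleanAlgebra (FreeTense X) where
  top := mk .top
  bot := mk .bot
  compl := map₁ .neg fun h A _ _ e => congrArg compl (h A e)
  le_top a := by
    induction a using ind
    exact mk_le_mk.2 fun A _ _ e => le_top
  bot_le a := by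
    induction a using ind
    exact mk_le_mk.2 fun A _ _ e => bot_le
  inf_compl_le_bot a := by
    induction a using ind with | h t => ?_
    exact mk_le_mk (s := .inf t (.neg t)).2 fun A _ _ e => BooleanAlgebra.inf_compl_le_bot _
  top_le_sup_compl a := by
    induction a using ind with | h t => ?_
    exact mk_le_mk (t := .sup t (.neg t)).2 fun A _ _ e => BooleanAlgebra.top_le_sup_compl _

instance : TenseAlgebra (FreeTense X) where
  opG := map₁ .allG fun h A _ _ e => congrArg opG (h A e)
  opH := map₁ .allH fun h A _ _ e => congrArg opH (h A e)
  gc_P_G a b := by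
    induction a using ind with | h s => ?_
    induction b using ind with | h t => ?_
    refine (mk_le_mk (s := .neg (.allH (.neg s)))).trans
      (Iff.trans ?_ (mk_le_mk (t := .allG t)).symm)
    exact forall₄_congr fun A _ _ e => gc_P_G (s.eval e) (t.eval e)
  gc_F_H a b := by
    induction a using ind with | h s => ?_
    induction b using ind with | h t => ?_
    refine (mk_le_mk (s := .neg (.allG (.neg s)))).trans
      (Iff.trans ?_ (mk_le_mk (t := .allH t)).symm)
    exact forall₄_congr fun A _ _ e => gc_F_H (s.eval e) (t.eval e)

/-- The homomorphism from the free tense algebra that extends an assignment. -/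
def lift {B : Type u} [BooleanAlgebra B] [TenseAlgebra B] (e : X → B) :
    TenseHom (FreeTense X) B where
  toFun := Quotient.lift (TenseTerm.eval e) fun _ _ h => h B e
  map_sup' a b := by induction a using ind; induction b using ind; rfl
  map_inf' a b := by induction a using ind; induction b using ind; rfl
  map_top' := rfl
  map_bot' := rfl
  map_opG' a := by induction a using ind; rfl
  map_opH' a := by induction a using ind; rfl

theorem hom_ext {B : Type u} [BooleanAlgebra B] [TenseAlgebra B]
    {f g : TenseHom (FreeTense X) B} (h : ∀ x, f.toFun (gen x) = g.toFun (gen x)) : f = g := by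
  refine TenseHom.ext_fun fun a => ?_
  induction a using ind with | h t => ?_
  induction t with
  | var x => exact h x
  | bot => exact f.map_bot'.trans g.map_bot'.symm
  | top => exact f.map_top'.trans g.map_top'.symm
  | inf s t hs ht =>
    exact (f.map_inf' (mk s) (mk t)).trans
      ((congrArg₂ (· ⊓ ·) hs ht).trans (g.map_inf' (mk s) (mk t)).symm)
  | sup s t hs ht =>
    exact (f.map_sup' (mk s) (mk t)).trans
      ((congrArg₂ (· ⊔ ·) hs ht).trans (g.map_sup' (mk s) (mk t)).symm)
  | neg s hs =>
    exact (map_compl' f.toBoundedLatticeHom (mk s)).trans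
      ((congrArg compl hs).trans (map_compl' g.toBoundedLatticeHom (mk s)).symm)
  | allG s hs =>
    exact (f.map_opG' (mk s)).trans ((congrArg opG hs).trans (g.map_opG' (mk s)).symm)
  | allH s hs =>
    exact (f.map_opH' (mk s)).trans ((congrArg opH hs).trans (g.map_opH' (mk s)).symm)

end FreeTense

/-- The free WHB-algebra functor `F_WHB`. -/
def freeWHB : Type u ⥤ WHBAlg.{u} where
  obj X := ⟨FreeWHB X⟩
  map {X Y} l := FreeWHB.lift (A := FreeWHB Y) fun x => FreeWHB.gen (l x)
  map_id _ := FreeWHB.hom_ext fun _ => rfl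
  map_comp _ _ := FreeWHB.hom_ext fun _ => rfl

/-- The free tense algebra functor `F_TBA`. -/
def freeTense : Type u ⥤ TBAlg.{u} where
  obj X := ⟨FreeTense X⟩
  map {X Y} l := FreeTense.lift (B := FreeTense Y) fun x => FreeTense.gen (l x)
  map_id _ := FreeTense.hom_ext fun _ => rfl
  map_comp _ _ := FreeTense.hom_ext fun _ => rfl

/-! ## Validity of equations -/

/-- `A ⊨ s ≈ t` for terms in `{∧, ∨, →, ←, 0, 1}`; an equation is a pair of terms. -/
def WHBValid {X : Type u} (A : Type v) [DistribLattice A] [BoundedOrder A] [WHBAlgebra A]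
    (E : WHBTerm X × WHBTerm X) : Prop := ∀ e : X → A, E.1.eval e = E.2.eval e

/-- `A ⊨ s ≈ t` for terms in `{∧, ∨, →, ←, ¬, 0, 1}`, where `A` is a WHB-algebra whose lattice
reduct is Boolean. -/
def WHBNegValid {X : Type u} (A : Type v) [BooleanAlgebra A] [WHBAlgebra A]
    (E : WHBNegTerm X × WHBNegTerm X) : Prop := ∀ e : X → A, E.1.eval e = E.2.eval e

/-- `B ⊨ s ≈ t` for terms in `{∧, ∨, ¬, G, H, 0, 1}`. -/
def TenseValid {X : Type u} (B : Type v) [BooleanAlgebra B] [TenseAlgebra B]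
    (E : TenseTerm X × TenseTerm X) : Prop := ∀ e : X → B, E.1.eval e = E.2.eval e

theorem WHBAlgebra.gc_wDiff_sImp {A : Type u} [DistribLattice A] [BoundedOrder A]
    [WHBAlgebra A] (x y : A) : wDiff x ⊥ ≤ y ↔ x ≤ sImp ⊤ y := by
  constructor
  · intro h
    have h2 := e2 x (⊥ : A)
    rw [bot_sup_eq] at h2
    refine h2.trans ?_
    have := sImp_inf ⊤ (wDiff x ⊥) y
    rw [inf_eq_left.2 h] at this
    exact this.le.trans inf_le_right
  · intro h
    have h1 := e1 (⊤ : A) y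
    rw [top_inf_eq] at h1
    refine le_trans ?_ h1
    have := sup_wDiff x (sImp ⊤ y) (⊥ : A)
    rw [sup_eq_right.2 h] at this
    exact le_sup_left.trans this.ge

/-- The tense algebra of a WHB-algebra whose lattice reduct is Boolean:
`G x = 1 → x` and `H x = ¬ (¬ x ← 0)`. -/
@[reducible] def WHBAlgebra.toTense (A : Type u) [BooleanAlgebra A] [WHBAlgebra A] :
    TenseAlgebra A where
  opG x := sImp ⊤ x
  opH x := (wDiff xᶜ ⊥)ᶜ
  gc_P_G x y := by
    simp only [compl_compl]
    exact gc_wDiff_sImp x y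
  gc_F_H x y := by
    rw [compl_le_iff_compl_le, le_compl_comm]
    exact (gc_wDiff_sImp yᶜ xᶜ).symm

/-! ## Tense algebras as WHB-algebras -/

/-! For the isomorphism, extend `x ↦ σ(x)` to a tense homomorphism `f` from the free tense algebra
on `X` to the free tense extension of the free WHB-algebra on `X`.

Surjectivity of `f` rests on `stoneB_sImp` and `stoneB_wDiff`: `σ(a → b) = G(¬σ(a) ∨ σ(b))` and `σ(a
← b) = ¬H(¬σ(a) ∨ σ(b))`. The image of `f`, being a tense subalgebra that contains the generators,
thus contains every `σ(a)`, and these generate the extension as a Boolean algebra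
(`mem_of_stoneB_mem`).

For injectivity, a tense algebra is itself a WHB-algebra (`TenseAlgebra.toWHB`), so the generators
induce a WHB-homomorphism `k` from the free WHB-algebra to the free tense algebra. The composite
`T(k) ∘ f` agrees on generators with the Stone map of the free tense algebra, which is a tense
homomorphism (`stoneTenseHom`) and injective by the prime filter theorem.

For equations, over a Boolean lattice `x → y = (x ∧ ¬y) → 0` and `x ← y = (x ∧ ¬y) ← 0`. Since `· →
0` turns joins into meets and `· ← 0` preserves joins, both send a finite join of differences `s \
t` of negation-free terms to a negation-free term. Hence every term with negation equals such a
join, and the list of pairs `(s, t)` depends on the term alone, not on the algebra. An equation says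
that the symmetric difference of its sides vanishes; in normal form this is a finite list of
inequalities `s ≤ t`. Tense equations reduce to this case by translating `G` and `H`. -/

theorem TenseAlgebra.opG_top {B : Type u} [BooleanAlgebra B] [TenseAlgebra B] :
    opG (⊤ : B) = ⊤ :=
  gc_P_G.u_top

theorem TenseAlgebra.opG_inf {B : Type u} [BooleanAlgebra B] [TenseAlgebra B] (x y : B) :
    opG (x ⊓ y) = opG x ⊓ opG y :=
  gc_P_G.u_inf

theorem TenseAlgebra.opH_top {B : Type u} [BooleanAlgebra B] [TenseAlgebra B] :
    opH (⊤ : B) = ⊤ :=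
  gc_F_H.u_top

theorem TenseAlgebra.opH_inf {B : Type u} [BooleanAlgebra B] [TenseAlgebra B] (x y : B) :
    opH (x ⊓ y) = opH x ⊓ opH y :=
  gc_F_H.u_inf

/-- Transitivity of material implication. Monotonicity of `G` and `H` turns it into the transitivity
axioms for `→` and `←`. -/
theorem compl_sup_inf_compl_sup_le {B : Type u} [BooleanAlgebra B] (a b c : B) :
    (aᶜ ⊔ b) ⊓ (bᶜ ⊔ c) ≤ aᶜ ⊔ c := by
  rw [sup_comm aᶜ, sup_comm bᶜ, sup_comm aᶜ, ← himp_eq, ← himp_eq, ← himp_eq]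
  exact himp_triangle a b c

/-- A tense algebra is a WHB-algebra with `a → b = G (¬ a ∨ b)` and
`a ← b = ¬ H (¬ a ∨ b) = P (a ∧ ¬ b)`. -/
@[reducible] def TenseAlgebra.toWHB (B : Type u) [BooleanAlgebra B] [TenseAlgebra B] :
    WHBAlgebra B where
  sImp a b := opG (aᶜ ⊔ b)
  wDiff a b := (opH (aᶜ ⊔ b))ᶜ
  sImp_self a := by rw [compl_sup_eq_top, opG_top]
  sImp_inf a b c := by rw [sup_inf_left, opG_inf]
  sup_sImp a b c := by rw [compl_sup, sup_inf_right, opG_inf]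
  sImp_trans a b c := by
    rw [← opG_inf]
    exact gc_P_G.monotone_u (compl_sup_inf_compl_sup_le a b c)
  wDiff_self a := by rw [compl_sup_eq_top, opH_top, compl_top]
  sup_wDiff a b c := by rw [compl_sup, sup_inf_right, opH_inf, compl_inf]
  wDiff_inf a b c := by rw [sup_inf_left, opH_inf, compl_inf]
  wDiff_trans a b c := by
    rw [← compl_inf, ← opH_inf]
    exact compl_le_compl (gc_F_H.monotone_u (compl_sup_inf_compl_sup_le a b c))
  e1 a b := by
    -- Since `x ← 0` is `P x`, this axiom comes from the counit `P G ≤ id` at `¬a ∨ b`.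
    rw [sup_bot_eq]
    refine (inf_le_inf_left a (gc_P_G.l_u_le (aᶜ ⊔ b))).trans ?_
    rw [inf_sup_left, inf_compl_eq_bot, bot_sup_eq]
    exact inf_le_right
  e2 a b := by
    -- Since `a ← b` is `P (a ∧ ¬b)` and `1 → x` is `G x`, this axiom comes from the unit `id ≤ G
    -- P`.
    have h := gc_P_G.le_u_l (a ⊓ bᶜ)
    simp only [compl_inf, compl_compl] at h
    rw [compl_top, bot_sup_eq]
    calc a ≤ b ⊔ a ⊓ bᶜ := by rw [sup_inf_left, sup_compl_eq_top, inf_top_eq]; exact le_sup_right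
      _ ≤ _ := sup_le_sup_left h b

/-! ## The Stone map into the free tense extension -/

section StoneB

variable {A : Type u} [DistribLattice A] [BoundedOrder A]

/-- The prime filter theorem: the separation lemma applied with the order itself as the lattice
preorder. -/
theorem stoneB_injective : Function.Injective (stoneB (A := A)) := by
  have key : ∀ a b : A, stone a = stone b → a ≤ b := by
    intro a b h
    by_contra hab
    obtain ⟨Q, ha, hb, -⟩ := exists_primeFilter_of_not_rel (fun x y : A => x ≤ y)
      (fun _ _ => id) (fun _ _ _ => le_trans) (fun _ _ _ => le_inf) (fun _ _ _ => sup_le) hab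
    exact hb (h.le ha)
  intro a b h
  have h' : stone a = stone b := congrArg Subtype.val h
  exact le_antisymm (key a b h') (key b a h'.symm)

theorem stoneB_inf (a b : A) : stoneB (a ⊓ b) = stoneB a ⊓ stoneB b :=
  Subtype.ext (stone_inf a b)

theorem stoneB_sup (a b : A) : stoneB (a ⊔ b) = stoneB a ⊔ stoneB b :=
  Subtype.ext (stone_sup a b)

theorem stoneB_bot : stoneB (⊥ : A) = ⊥ := Subtype.ext stone_bot

theorem stoneB_top : stoneB (⊤ : A) = ⊤ := Subtype.ext stone_top

theorem compl_compl_sup_stone (a b : A) : ((stone a)ᶜ ⊔ stone b)ᶜ = stone a \ stone b := by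
  rw [compl_sup, compl_compl, sdiff_eq]

/-- `R⁻¹(σ(a) \ σ(b))` is the complement of `σ(a → b)`, and `σ(a) \ σ(b)` is the complement of
`¬σ(a) ∨ σ(b)`. This expresses `→` by the tense operations of the extension. -/
theorem stoneB_sImp [WHBAlgebra A] (a b : A) :
    stoneB (sImp a b) = opG ((stoneB a)ᶜ ⊔ stoneB b) := by
  refine Subtype.ext ?_
  change stone (sImp a b) = (relPre relR ((stone a)ᶜ ⊔ stone b)ᶜ)ᶜ
  rw [compl_compl_sup_stone, relPre_relR, compl_compl]

theorem stoneB_wDiff [WHBAlgebra A] (a b : A) :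
    stoneB (wDiff a b) = (opH ((stoneB a)ᶜ ⊔ stoneB b))ᶜ := by
  refine Subtype.ext ?_
  change stone (wDiff a b) = (relPre relS ((stone a)ᶜ ⊔ stone b)ᶜ)ᶜᶜ
  rw [compl_compl_sup_stone, relPre_relS, compl_compl]

/-- A Boolean subalgebra of the free Boolean extension that contains the image of the Stone map
is everything. -/
theorem mem_of_stoneB_mem (S : BooleanSubalgebra (boolExt A)) (h : ∀ a, stoneB a ∈ S)
    (U : boolExt A) : U ∈ S := by
  -- Induction on the number of differences. The element `V` is known only through its underlying
  -- set, so the hypothesis applies to the remaining union once that is seen to lie in `boolExt A`.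
  have key : ∀ (n : ℕ) (a b : Fin n → A) (V : boolExt A),
      V.1 = (⋃ i, stone (a i) \ stone (b i)) → V ∈ S := by
    intro n
    induction n with
    | zero =>
      intro a b V hV
      have : V = ⊥ := Subtype.ext (hV.trans (Set.iUnion_of_empty _))
      exact this ▸ BooleanSubalgebra.bot_mem
    | succ n ih =>
      intro a b V hV
      have hW := mem_boolExt.2 ⟨n, fun i => a i.succ, fun i => b i.succ, rfl⟩
      have : V = (stoneB (a 0) ⊓ (stoneB (b 0))ᶜ) ⊔ ⟨_, hW⟩ := by
        refine Subtype.ext (hV.trans ?_)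
        change _ = (stone (a 0) ∩ (stone (b 0))ᶜ) ∪ ⋃ i : Fin n, _
        ext P
        simp [Fin.exists_fin_succ, Set.mem_sdiff]
      rw [this]
      exact BooleanSubalgebra.sup_mem
        (BooleanSubalgebra.inf_mem (h _) (BooleanSubalgebra.compl_mem (h _)))
        (ih _ _ ⟨_, hW⟩ rfl)
  obtain ⟨n, a, b, hU⟩ := mem_boolExt.1 U.2
  exact key n a b U hU

end StoneB

/-- The Stone map of a tense algebra as a homomorphism of tense algebras. -/
def stoneTenseHom (B : Type u) [BooleanAlgebra B] [TenseAlgebra B] :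
    letI := TenseAlgebra.toWHB B
    TenseHom B (boolExt B) :=
  letI := TenseAlgebra.toWHB B
  { toFun := stoneB
    map_sup' := stoneB_sup
    map_inf' := stoneB_inf
    map_top' := stoneB_top
    map_bot' := stoneB_bot
    map_opG' := fun a => by
      -- In the WHB-structure of a tense algebra, `1 → a` is `G a`.
      have h := stoneB_sImp (⊤ : B) a
      rwa [stoneB_top, compl_top, bot_sup_eq,
        show sImp (⊤ : B) a = opG a by change opG ((⊤ : B)ᶜ ⊔ a) = _; rw [compl_top, bot_sup_eq]]
        at h
    map_opH' := fun a => by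
      -- Dually `1 ← a` is `¬H a`, so the formula for `←` gives `H` only up to complement; `hc`
      -- removes the complement.
      have h := stoneB_wDiff (⊤ : B) a
      have hw : wDiff (⊤ : B) a = (opH a)ᶜ := by
        change (opH ((⊤ : B)ᶜ ⊔ a))ᶜ = _
        rw [compl_top, bot_sup_eq]
      rw [stoneB_top, compl_top, bot_sup_eq, hw] at h
      have hc : stoneB (opH a)ᶜ = (stoneB (opH a))ᶜ := by
        refine eq_compl_iff_isCompl.2 (IsCompl.symm (IsCompl.of_eq ?_ ?_))
        · rw [← stoneB_inf, inf_compl_eq_bot, stoneB_bot]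
        · rw [← stoneB_sup, sup_compl_eq_top, stoneB_top]
      exact compl_injective (hc.symm.trans h) }

/-! ## The free tense algebra as the free tense extension of the free WHB-algebra -/

section Free

variable (X : Type u)

/-- The homomorphism from the free tense algebra to the free tense extension of the free
WHB-algebra that matches the free generators. -/
def freeTenseToExt : TenseHom (FreeTense X) (boolExt (FreeWHB X)) :=
  FreeTense.lift fun x => stoneB (FreeWHB.gen x)

/-- Followed by `T(k)`, the map becomes the Stone map of the free tense algebra: both are tense
homomorphisms sending each generator `x` to `σ(x)`. The Stone map is injective. -/
theorem freeTenseToExt_injective : Function.Injective (freeTenseToExt X).toFun := by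
  let := TenseAlgebra.toWHB (FreeTense X)
  let k : WHBHom (FreeWHB X) (FreeTense X) := FreeWHB.lift FreeTense.gen
  let f : (⟨FreeTense X⟩ : TBAlg.{u}) ⟶ ⟨boolExt (FreeWHB X)⟩ := freeTenseToExt X
  let g : (⟨boolExt (FreeWHB X)⟩ : TBAlg.{u}) ⟶ ⟨boolExt (FreeTense X)⟩ := tenseExtMap k
  have h : (show TenseHom (FreeTense X) (boolExt (FreeTense X)) from f ≫ g) =
      stoneTenseHom (FreeTense X) := FreeTense.hom_ext fun _ => rfl
  intro a b hab
  apply stoneB_injective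
  have ha := congrArg (fun l => l.toFun a) h
  have hb := congrArg (fun l => l.toFun b) h
  exact ha.symm.trans ((congrArg (tenseExtMap k).toFun hab).trans hb)

/-- The image is a Boolean subalgebra closed under `G` and `H`, so induction on WHB-terms puts every
`σ(a)` in it. These already generate the extension by Boolean operations alone. -/
theorem freeTenseToExt_surjective : Function.Surjective (freeTenseToExt X).toFun := by
  let S : BooleanSubalgebra (boolExt (FreeWHB X)) :=
    BooleanSubalgebra.map (freeTenseToExt X).toBoundedLatticeHom ⊤
  have hG : ∀ U ∈ S, opG U ∈ S := by
    rintro _ ⟨s, -, rfl⟩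
    exact ⟨opG s, trivial, (freeTenseToExt X).map_opG' s⟩
  have hH : ∀ U ∈ S, opH U ∈ S := by
    rintro _ ⟨s, -, rfl⟩
    exact ⟨opH s, trivial, (freeTenseToExt X).map_opH' s⟩
  have hS : ∀ a : FreeWHB X, stoneB a ∈ S := by
    intro a
    induction a using FreeWHB.ind with | h t => ?_
    induction t with
    | var x => exact ⟨FreeTense.gen x, trivial, rfl⟩
    | bot =>
      rw [show FreeWHB.mk (X := X) .bot = ⊥ from rfl, stoneB_bot]
      exact BooleanSubalgebra.bot_mem
    | top =>
      rw [show FreeWHB.mk (X := X) .top = ⊤ from rfl, stoneB_top]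
      exact BooleanSubalgebra.top_mem
    | inf s t hs ht =>
      rw [show FreeWHB.mk (.inf s t) = FreeWHB.mk s ⊓ FreeWHB.mk t from rfl, stoneB_inf]
      exact BooleanSubalgebra.inf_mem hs ht
    | sup s t hs ht =>
      rw [show FreeWHB.mk (.sup s t) = FreeWHB.mk s ⊔ FreeWHB.mk t from rfl, stoneB_sup]
      exact BooleanSubalgebra.sup_mem hs ht
    | imp s t hs ht =>
      rw [show FreeWHB.mk (.imp s t) = sImp (FreeWHB.mk s) (FreeWHB.mk t) from rfl, stoneB_sImp]
      exact hG _ (BooleanSubalgebra.sup_mem (BooleanSubalgebra.compl_mem hs) ht)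
    | diff s t hs ht =>
      rw [show FreeWHB.mk (.diff s t) = wDiff (FreeWHB.mk s) (FreeWHB.mk t) from rfl,
        stoneB_wDiff]
      exact BooleanSubalgebra.compl_mem
        (hH _ (BooleanSubalgebra.sup_mem (BooleanSubalgebra.compl_mem hs) ht))
  intro U
  obtain ⟨s, -, hs⟩ := mem_of_stoneB_mem S hS U
  exact ⟨s, hs⟩

end Free

/-! ### Assembling the natural isomorphism -/

/-- The inverse of a bijective homomorphism of tense algebras. -/
noncomputable def TenseHom.inverse {A B : Type u} [BooleanAlgebra A] [TenseAlgebra A] [BooleanAlgebra B]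
    [TenseAlgebra B] (f : TenseHom A B) (hf : Function.Bijective f.toFun) : TenseHom B A :=
  let e := Equiv.ofBijective f.toFun hf
  have he : ∀ b, f.toFun (e.symm b) = b := e.apply_symm_apply
  { toFun := e.symm
    map_sup' := fun a b => hf.1 <| by
      rw [he]; exact ((f.map_sup' _ _).trans (congrArg₂ _ (he a) (he b))).symm
    map_inf' := fun a b => hf.1 <| by
      rw [he]; exact ((f.map_inf' _ _).trans (congrArg₂ _ (he a) (he b))).symm
    map_top' := hf.1 <| (he _).trans f.map_top'.symm
    map_bot' := hf.1 <| (he _).trans f.map_bot'.symm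
    map_opG' := fun a => hf.1 <| by
      rw [he]; exact ((f.map_opG' _).trans (congrArg _ (he a))).symm
    map_opH' := fun a => hf.1 <| by
      rw [he]; exact ((f.map_opH' _).trans (congrArg _ (he a))).symm }

/-- A bijective homomorphism of tense algebras is an isomorphism. -/
noncomputable def TBAlg.isoOfBijective {A B : TBAlg.{u}} (f : TenseHom A.carrier B.carrier)
    (hf : Function.Bijective f.toFun) : A ≅ B where
  hom := f
  inv := f.inverse hf
  hom_inv_id := TenseHom.ext_fun (Equiv.ofBijective f.toFun hf).symm_apply_apply
  inv_hom_id := TenseHom.ext_fun (Equiv.ofBijective f.toFun hf).apply_symm_apply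

/-- The natural isomorphism between `F_TBA` and `T ∘ F_WHB`. -/
noncomputable def freeTenseIso : freeTense.{u} ≅ freeWHB.{u} ⋙ tenseExt.{u} :=
  NatIso.ofComponents
    (fun X => TBAlg.isoOfBijective (A := freeTense.obj X) (B := tenseExt.obj (freeWHB.obj X))
      (freeTenseToExt X) ⟨freeTenseToExt_injective X, freeTenseToExt_surjective X⟩)
    -- Both paths of the naturality square for `l` send a generator `x` to `σ(l x)`.
    (fun _ => FreeTense.hom_ext fun _ => rfl)

/-! ## Normal forms in WHB-algebras with Boolean lattice reduct -/

section Boolean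

variable {A : Type v} [BooleanAlgebra A] [WHBAlgebra A]

/-- Split `x` into `x ∧ y` and `x \ y`: the first part is below `y` and contributes `⊤`. Then write
`0 = y ∧ ¬y`, where `x \ y ≤ ¬y` makes the conjunct `(x \ y) → ¬y` equal to `⊤`. -/
theorem sImp_eq_sdiff (x y : A) : sImp x y = sImp (x \ y) ⊥ := by
  have h1 : sImp x y = sImp (x \ y) y := by
    conv_lhs => rw [← sup_inf_sdiff x y]
    rw [sup_sImp, sImp_eq_top inf_le_right, top_inf_eq]
  rw [h1, show (⊥ : A) = y ⊓ yᶜ from inf_compl_eq_bot.symm, sImp_inf, sdiff_eq,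
    sImp_eq_top (inf_le_right : x ⊓ yᶜ ≤ yᶜ), inf_top_eq]

theorem wDiff_eq_sdiff (x y : A) : wDiff x y = wDiff (x \ y) ⊥ := by
  have h1 : wDiff x y = wDiff (x \ y) y := by
    conv_lhs => rw [← sup_inf_sdiff x y]
    rw [sup_wDiff, wDiff_eq_bot inf_le_right, bot_sup_eq]
  rw [h1, show (⊥ : A) = y ⊓ yᶜ from inf_compl_eq_bot.symm, wDiff_inf, sdiff_eq,
    wDiff_eq_bot (inf_le_right : x ⊓ yᶜ ≤ yᶜ), sup_bot_eq]

/-- The value of the join of the differences of the pairs of terms in a list. -/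
def supSdiff {X : Type u} (e : X → A) : List (WHBTerm X × WHBTerm X) → A
  | [] => ⊥
  | p :: L => (p.1.eval e \ p.2.eval e) ⊔ supSdiff e L

theorem supSdiff_append {X : Type u} (e : X → A) (L M : List (WHBTerm X × WHBTerm X)) :
    supSdiff e (L ++ M) = supSdiff e L ⊔ supSdiff e M := by
  induction L with
  | nil => exact (bot_sup_eq _).symm
  | cons p L ih => exact (congrArg _ ih).trans (sup_assoc _ _ _).symm

/-- Turns the vanishing of a normal form into inequalities between negation-free terms. -/
theorem supSdiff_eq_bot {X : Type u} (e : X → A) (L : List (WHBTerm X × WHBTerm X)) :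
    supSdiff e L = ⊥ ↔ ∀ p ∈ L, p.1.eval e ≤ p.2.eval e := by
  induction L with
  | nil => simp [supSdiff]
  | cons p L ih => rw [supSdiff, sup_eq_bot_iff, sdiff_eq_bot_iff, ih, List.forall_mem_cons]

end Boolean

/-! ### Closure of the normal forms under all operations -/

/-- `f` is an operation, uniformly defined on WHB-algebras with Boolean lattice reduct, that is
given by a finite join of differences of terms with variables in `V`. -/
def IsSupSdiff {X : Type u} (V : Set X)
    (f : ∀ (A : Type v) [BooleanAlgebra A] [WHBAlgebra A], (X → A) → A) : Prop :=
  ∃ L : List (WHBTerm X × WHBTerm X), (∀ p ∈ L, p.1.vars ∪ p.2.vars ⊆ V) ∧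
    ∀ (A : Type v) [BooleanAlgebra A] [WHBAlgebra A] (e : X → A), f A e = supSdiff e L

namespace IsSupSdiff

variable {X : Type u} {V W : Set X}
  {f g : ∀ (A : Type v) [BooleanAlgebra A] [WHBAlgebra A], (X → A) → A}

theorem mono (hf : IsSupSdiff V f) (h : V ⊆ W) : IsSupSdiff W f := by
  obtain ⟨L, hL, hLf⟩ := hf
  exact ⟨L, fun p hp => (hL p hp).trans h, hLf⟩

theorem sdiff_terms {s t : WHBTerm X} (hs : s.vars ⊆ V) (ht : t.vars ⊆ V) :
    IsSupSdiff.{u, v} V fun _ _ _ e => s.eval e \ t.eval e :=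
  ⟨[(s, t)], by simpa using ⟨hs, ht⟩, fun _ _ _ _ => (sup_bot_eq _).symm⟩

theorem term {t : WHBTerm X} (ht : t.vars ⊆ V) : IsSupSdiff.{u, v} V fun _ _ _ e => t.eval e := by
  obtain ⟨L, hL, hLf⟩ := sdiff_terms.{u, v} (t := .bot) ht (Set.empty_subset V)
  exact ⟨L, hL, fun A _ _ e => (sdiff_bot (a := t.eval e)).symm.trans (hLf A e)⟩

theorem sup (hf : IsSupSdiff V f) (hg : IsSupSdiff V g) :
    IsSupSdiff V fun A _ _ e => f A e ⊔ g A e := by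
  obtain ⟨L, hL, hLf⟩ := hf
  obtain ⟨M, hM, hMg⟩ := hg
  refine ⟨L ++ M, fun p hp => (List.mem_append.1 hp).elim (hL p) (hM p), fun A _ _ e => ?_⟩
  simp only [supSdiff_append, hLf, hMg]

/-- Differences are closed under meet, `(s \ t) ∧ (p \ q) = (s ∧ p) \ (t ∨ q)`, and meet distributes
over the join. -/
theorem sdiff_terms_inf {s t : WHBTerm X} (hs : s.vars ⊆ V) (ht : t.vars ⊆ V)
    (hg : IsSupSdiff V g) : IsSupSdiff V fun A _ _ e => (s.eval e \ t.eval e) ⊓ g A e := by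
  obtain ⟨M, hM, hMg⟩ := hg
  refine ⟨M.map fun p => (.inf s p.1, .sup t p.2), ?_, fun A _ _ e => ?_⟩
  · intro p hp
    obtain ⟨q, hq, rfl⟩ := List.mem_map.1 hp
    have := Set.union_subset_iff.1 (hM q hq)
    exact Set.union_subset (Set.union_subset hs this.1) (Set.union_subset ht this.2)
  · simp only [hMg]
    clear hM hMg
    induction M with
    | nil => exact inf_bot_eq _
    | cons q M ih =>
      rw [supSdiff, inf_sup_left, ih]
      refine congrArg (· ⊔ _) ?_
      change _ = (s.eval e ⊓ q.1.eval e) \ (t.eval e ⊔ q.2.eval e)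
      rw [sdiff_eq, sdiff_eq, sdiff_eq, compl_sup]
      exact inf_inf_inf_comm _ _ _ _

theorem inf (hf : IsSupSdiff V f) (hg : IsSupSdiff V g) :
    IsSupSdiff V fun A _ _ e => f A e ⊓ g A e := by
  obtain ⟨L, hL, hLf⟩ := hf
  simp only [hLf]
  clear hLf
  induction L with
  | nil => exact ⟨[], by simp, fun A _ _ e => bot_inf_eq _⟩
  | cons p L ih =>
    have hp := Set.union_subset_iff.1 (hL p List.mem_cons_self)
    simp only [supSdiff, inf_sup_right]
    exact (sdiff_terms_inf hp.1 hp.2 hg).sup (ih fun q hq => hL q (List.mem_cons_of_mem p hq))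

/-- By De Morgan the complement of a join of differences `s \ t` is a meet of joins `¬s ∨ t`. Here
`¬s = 1 \ s` and `t = t \ 0` are differences, and `inf` handles the meet. -/
theorem compl (hf : IsSupSdiff V f) : IsSupSdiff V fun A _ _ e => (f A e)ᶜ := by
  obtain ⟨L, hL, hLf⟩ := hf
  simp only [hLf]
  clear hLf
  induction L with
  | nil =>
    obtain ⟨M, hM, hMf⟩ := term.{u, v} (t := .top) (Set.empty_subset V)
    exact ⟨M, hM, fun A _ _ e => compl_bot.trans (hMf A e)⟩
  | cons p L ih =>
    have hp := Set.union_subset_iff.1 (hL p List.mem_cons_self)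
    obtain ⟨M, hM, hMf⟩ := sdiff_terms.{u, v} (s := .top) (Set.empty_subset V) hp.1
    have hc : IsSupSdiff.{u, v} V fun _ _ _ e => (p.1.eval e)ᶜ :=
      ⟨M, hM, fun A _ _ e => (top_sdiff' (p.1.eval e)).symm.trans (hMf A e)⟩
    simp only [supSdiff, compl_sup, sdiff_eq, compl_inf, compl_compl]
    exact (hc.sup (term hp.2)).inf (ih fun q hq => hL q (List.mem_cons_of_mem p hq))

/-- The negation disappears here: `· → 0` sends a join to a meet, and `(s \ t) → 0` is `s → t`, so
the result is the meet of the terms `s → t`. -/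
theorem exists_sImp_bot (hf : IsSupSdiff V f) : ∃ t : WHBTerm X, t.vars ⊆ V ∧
    ∀ (A : Type v) [BooleanAlgebra A] [WHBAlgebra A] (e : X → A),
      sImp (f A e) ⊥ = t.eval e := by
  obtain ⟨L, hL, hLf⟩ := hf
  simp only [hLf]
  clear hLf
  induction L with
  | nil => exact ⟨.top, Set.empty_subset V, fun A _ _ e => sImp_self _⟩
  | cons p L ih =>
    obtain ⟨t, ht, htL⟩ := ih fun q hq => hL q (List.mem_cons_of_mem p hq)
    refine ⟨.inf (.imp p.1 p.2) t, Set.union_subset (hL p List.mem_cons_self) ht,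
      fun A _ _ e => ?_⟩
    rw [supSdiff, sup_sImp, htL, ← sImp_eq_sdiff]
    rfl

/-- Likewise, `· ← 0` preserves joins and `(s \ t) ← 0` is `s ← t`, so the result is the join of the
terms `s ← t`. -/
theorem exists_wDiff_bot (hf : IsSupSdiff V f) : ∃ t : WHBTerm X, t.vars ⊆ V ∧
    ∀ (A : Type v) [BooleanAlgebra A] [WHBAlgebra A] (e : X → A),
      wDiff (f A e) ⊥ = t.eval e := by
  obtain ⟨L, hL, hLf⟩ := hf
  simp only [hLf]
  clear hLf
  induction L with
  | nil => exact ⟨.bot, Set.empty_subset V, fun A _ _ e => wDiff_self _⟩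
  | cons p L ih =>
    obtain ⟨t, ht, htL⟩ := ih fun q hq => hL q (List.mem_cons_of_mem p hq)
    refine ⟨.sup (.diff p.1 p.2) t, Set.union_subset (hL p List.mem_cons_self) ht,
      fun A _ _ e => ?_⟩
    rw [supSdiff, sup_wDiff, htL, ← wDiff_eq_sdiff]
    rfl

theorem sImp (hf : IsSupSdiff V f) (hg : IsSupSdiff V g) :
    IsSupSdiff V fun A _ _ e => sImp (f A e) (g A e) := by
  -- `f → g` is `(f ∧ ¬g) → 0`, and `f ∧ ¬g` has a normal form; so `f → g` is a single negation-free
  -- term.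
  obtain ⟨t, ht, h⟩ := (hf.inf hg.compl).exists_sImp_bot
  simp only [sImp_eq_sdiff (f _ _), sdiff_eq, h]
  exact term ht

theorem wDiff (hf : IsSupSdiff V f) (hg : IsSupSdiff V g) :
    IsSupSdiff V fun A _ _ e => wDiff (f A e) (g A e) := by
  obtain ⟨t, ht, h⟩ := (hf.inf hg.compl).exists_wDiff_bot
  simp only [wDiff_eq_sdiff (f _ _), sdiff_eq, h]
  exact term ht

end IsSupSdiff

/-! ### Equations as finite sets of inequalities -/

theorem WHBNegTerm.isSupSdiff {X : Type u} (t : WHBNegTerm X) :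
    IsSupSdiff.{u, v} t.vars fun _ _ _ e => t.eval e := by
  induction t with
  | var x => exact IsSupSdiff.term (t := .var x) subset_rfl
  | bot => exact IsSupSdiff.term (t := .bot) subset_rfl
  | top => exact IsSupSdiff.term (t := .top) subset_rfl
  | inf s t hs ht => exact (hs.mono Set.subset_union_left).inf (ht.mono Set.subset_union_right)
  | sup s t hs ht => exact (hs.mono Set.subset_union_left).sup (ht.mono Set.subset_union_right)
  | imp s t hs ht => exact (hs.mono Set.subset_union_left).sImp (ht.mono Set.subset_union_right)
  | diff s t hs ht => exact (hs.mono Set.subset_union_left).wDiff (ht.mono Set.subset_union_right)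
  | neg s hs => exact hs.compl

/-- Over WHB-algebras with Boolean lattice reduct, an equation with negation is equivalent to a
finite set of inequalities without negation. -/
theorem exists_finite_inequalities {X : Type u} (E : WHBNegTerm X × WHBNegTerm X) :
    ∃ Γ : Set (WHBTerm X × WHBTerm X), Γ.Finite ∧
      (∀ D ∈ Γ, ∃ δ ε : WHBTerm X, D = (.inf δ ε, δ) ∧
        δ.vars ∪ ε.vars ⊆ E.1.vars ∪ E.2.vars) ∧
      ∀ (A : Type v) [BooleanAlgebra A] [WHBAlgebra A],
        WHBNegValid A E ↔ ∀ D ∈ Γ, WHBValid A D := by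
  have h1 := E.1.isSupSdiff.{u, v}.mono (Set.subset_union_left (t := E.2.vars))
  have h2 := E.2.isSupSdiff.{u, v}.mono (Set.subset_union_right (s := E.1.vars))
  -- Normal form of the symmetric difference of the two sides, which vanishes exactly when they
  -- agree.
  obtain ⟨L, hL, hLE⟩ := (h1.inf h2.compl).sup (h2.inf h1.compl)
  refine ⟨(fun p => (.inf p.1 p.2, p.1)) '' {p | p ∈ L}, L.finite_toSet.image _, ?_,
    fun A _ _ => ?_⟩
  · rintro _ ⟨p, hp, rfl⟩
    exact ⟨p.1, p.2, rfl, hL p hp⟩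
  · rw [Set.forall_mem_image]
    have h : ∀ e : X → A, E.1.eval e = E.2.eval e ↔ ∀ p ∈ L, p.1.eval e ≤ p.2.eval e := by
      intro e
      rw [← supSdiff_eq_bot, ← hLE]
      simp only [← sdiff_eq]
      exact symmDiff_eq_bot.symm
    constructor
    · intro hE p hp e
      exact inf_eq_left.2 ((h e).1 (hE e) p hp)
    · intro hΓ e
      exact (h e).2 fun p hp => inf_eq_left.1 (hΓ hp e)

/-- The translation `G x = 1 → x`, `H x = ¬ (¬ x ← 0)` of tense terms. -/
def TenseTerm.toNegTerm {X : Type u} : TenseTerm X → WHBNegTerm X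
  | var x => .var x
  | bot => .bot
  | top => .top
  | inf s t => .inf s.toNegTerm t.toNegTerm
  | sup s t => .sup s.toNegTerm t.toNegTerm
  | neg s => .neg s.toNegTerm
  | allG s => .imp .top s.toNegTerm
  | allH s => .neg (.diff (.neg s.toNegTerm) .bot)

theorem TenseTerm.vars_toNegTerm {X : Type u} (t : TenseTerm X) : t.toNegTerm.vars = t.vars := by
  induction t <;> simp_all [toNegTerm, vars, WHBNegTerm.vars]

theorem TenseTerm.eval_toNegTerm {X : Type u} {A : Type v} [BooleanAlgebra A] [WHBAlgebra A]
    (e : X → A) (t : TenseTerm X) :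
    letI := WHBAlgebra.toTense A
    t.toNegTerm.eval e = t.eval e := by
  induction t <;> simp_all [toNegTerm, eval, WHBNegTerm.eval, opG, opH]

theorem mainTheorem7 :
    -- the natural isomorphism, which matches the free generators
    (∃ g : freeTense.{u} ≅ freeWHB.{u} ⋙ tenseExt.{u}, ∀ (X : Type u) (x : X),
      TBAlg.homFun (g.hom.app X) (FreeTense.gen x) = stoneB (FreeWHB.gen x)) ∧
    -- equations in the language of WHB-algebras with negation
    (∀ (X : Type u) (E : WHBNegTerm X × WHBNegTerm X),
      ∃ Γ : Set (WHBTerm X × WHBTerm X), Γ.Finite ∧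
        (∀ D ∈ Γ, ∃ δ ε : WHBTerm X, D = (.inf δ ε, δ) ∧
          δ.vars ∪ ε.vars ⊆ E.1.vars ∪ E.2.vars) ∧
        ∀ (A : Type v) [BooleanAlgebra A] [WHBAlgebra A],
          WHBNegValid A E ↔ ∀ D ∈ Γ, WHBValid A D) ∧
    -- equations in the language of tense algebras
    (∀ (X : Type u) (E : TenseTerm X × TenseTerm X),
      ∃ Γ : Set (WHBTerm X × WHBTerm X), Γ.Finite ∧
        (∀ D ∈ Γ, ∃ δ ε : WHBTerm X, D = (.inf δ ε, δ) ∧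
          δ.vars ∪ ε.vars ⊆ E.1.vars ∪ E.2.vars) ∧
        ∀ (A : Type v) [BooleanAlgebra A] [WHBAlgebra A],
          @TenseValid X A _ (WHBAlgebra.toTense A) E ↔ ∀ D ∈ Γ, WHBValid A D) := by
  refine ⟨⟨freeTenseIso, fun _ _ => rfl⟩, fun _ E => exists_finite_inequalities E, fun X E => ?_⟩
  obtain ⟨Γ, hfin, hΓ, h⟩ :=
    exists_finite_inequalities.{u, v} (E.1.toNegTerm, E.2.toNegTerm)
  refine ⟨Γ, hfin, ?_, fun A _ _ => Iff.trans (forall_congr' fun e => ?_) (h A)⟩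
  · simpa only [TenseTerm.vars_toNegTerm] using hΓ
  · rw [TenseTerm.eval_toNegTerm, TenseTerm.eval_toNegTerm]
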